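/- Let \[ F = \int_{[1,2]\times[0,1]^2}\int_{[0,1]^3}\frac{x_1-y_1}{\left((x_1-y_1)^2+(x_2-y_2)^2+(x_3-y_3)^2\right)^{3/2}}\,dy\,dx \] be the gravitational force (unit gravitational constant) between two homogeneous unit cubes of unit mass that touch along a common face, in the direction joining their centers. The integrand is Lebesgue integrable over $([1,2]\times[0,1]^2)\times[0,1]^3$, and \[ \begin{aligned} F ={}& -\frac{14}{3}+\frac{2\sqrt2}{3}-\frac{4\sqrt3}{3}+\frac{10\sqrt5}{3}-\frac{2\sqrt6}{3}+\frac{23\log 2}{3}-\frac{4\log 5}{3}\\ &+\frac{10}{3}\log(1+\sqrt2)+\frac{20}{3}\log(1+\sqrt3)-\frac{32}{3}\log(1+\sqrt5)+\frac{8}{3}\log(1+\sqrt6)\\ &-\frac13\log(2+\sqrt5)-\frac23\log(2+\sqrt6)-\frac{10\pi}{9}+8\arctan\frac{1}{2\sqrt6}+\frac43\arctan\frac{2}{\sqrt6}. \end{aligned} \] Moreover, the right-hand side equals Fornberg's expression \[ \begin{aligned} \frac13\Big(&-14+2\sqrt2-4\sqrt3+10\sqrt5-2\sqrt6+26\log 2-2\log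 5+10\log(1+\sqrt2)+20\log(1+\sqrt3)\\ &-35\log(1+\sqrt5)+6\log(1+\sqrt6)-2\log(4+\sqrt6)+\frac{26\pi}{3}-22\arctan(2\sqrt6)\Big). \end{aligned} \] -/

import Mathlib

noncomputable section

namespace TwoCubes

/-- The `j`-th component of the Newtonian `r⁻³` force kernel at the points `x` and `y` of `ℝ³`:
`(x_j - y_j) / ((x₀ - y₀)² + (x₁ - y₁)² + (x₂ - y₂)²)^{3/2}`. -/
def forceKernel (j : Fin 3) (x y : Fin 3 → ℝ) : ℝ :=
  (x j - y j) / ((x 0 - y 0) ^ 2 + (x 1 - y 1) ^ 2 + (x 2 - y 2) ^ 2) ^ (3 / 2 : ℝ)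

/-- The `j`-th component of the Newtonian force between homogeneous bodies of unit density
occupying `Q` and `Q'` (unit gravitational constant), as a sixfold Lebesgue integral. -/
def forceComponent (j : Fin 3) (Q Q' : Set (Fin 3 → ℝ)) : ℝ :=
  ∫ x in Q, ∫ y in Q', forceKernel j x y

/-- The cube `[1,2] × [0,1] × [0,1]`. -/
def cubeRight : Set (Fin 3 → ℝ) := Set.Icc ![1, 0, 0] ![2, 1, 1]

/-- The cube `[0,1] × [0,1] × [0,1]`. -/
def cubeLeft : Set (Fin 3 → ℝ) := Set.Icc ![0, 0, 0] ![1, 1, 1]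

/-- The force between the two touching unit cubes, in the direction joining their centers. -/
def twoCubesForce : ℝ := forceComponent 0 cubeRight cubeLeft

/-- The closed form with logarithms and small-argument arctangents. -/
def closedForm : ℝ :=
  -(14 / 3) + 2 * √2 / 3 - 4 * √3 / 3 + 10 * √5 / 3 - 2 * √6 / 3
    + 23 * Real.log 2 / 3 - 4 * Real.log 5 / 3
    + 10 / 3 * Real.log (1 + √2) + 20 / 3 * Real.log (1 + √3)
    - 32 / 3 * Real.log (1 + √5) + 8 / 3 * Real.log (1 + √6)
    - 1 / 3 * Real.log (2 + √5) - 2 / 3 * Real.log (2 + √6)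
    - 10 * Real.pi / 9 + 8 * Real.arctan (1 / (2 * √6)) + 4 / 3 * Real.arctan (2 / √6)

/-- Fornberg's fourteen-term closed form. -/
def fornbergForm : ℝ :=
  1 / 3 * (-14 + 2 * √2 - 4 * √3 + 10 * √5 - 2 * √6 + 26 * Real.log 2 - 2 * Real.log 5
    + 10 * Real.log (1 + √2) + 20 * Real.log (1 + √3) - 35 * Real.log (1 + √5)
    + 6 * Real.log (1 + √6) - 2 * Real.log (4 + √6)
    + 26 * Real.pi / 3 - 22 * Real.arctan (2 * √6))

end TwoCubes

end

noncomputable section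

namespace TwoCubes

open Real Set MeasureTheory

/-! The kernel depends only on t = x - y = (u, v, w) and is nonnegative on the two cubes, so Tonelli
turns the sixfold integral into a threefold one: the kernel at t, weighted by the volume of the
overlap of one cube with the translate of the other by t. That volume is a product of three hat
functions, min u (2 - u), 1 - |v| and 1 - |w|, cut off at zero.

The u-integral is elementary and gives `overlapLog`, a combination with coefficients 2, -1, -1 of
log (a + √(a² + v² + w²)) at a = 1, 2, 0 (`integral_min_mul_kernel`). It is even in v and in w, so
four times the integral over the unit square remains. The w-integral is `innerLog a v`
(`integral_innerLog`). The v-integral has the primitive `outerPrim` for a > 0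
(`hasDerivAt_outerPrim`), while a = 0 is singular at the origin and has its own primitive
`outerPrimZero`. Endpoint values are reduced to common logarithms, π and arctan (1 / (2√6)).

The reduction is carried out with `ENNReal`-valued integrals, so finiteness of the closed form also
yields integrability (`lintegral_kernel_eq`, `integrableOn_forceKernel`). -/

/-! ### The inner integral, over w -/

/-- The integral `∫₀¹ (1 - w) log (a + √(a² + v² + w²)) dw` in closed form. -/
def innerLog (a v : ℝ) : ℝ :=
  (1 - v ^ 2) / 2 * log (a + √(a ^ 2 + v ^ 2 + 1)) + v ^ 2 / 2 * log (a + √(a ^ 2 + v ^ 2))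
    + a * log (1 + √(a ^ 2 + v ^ 2 + 1)) - a * log √(a ^ 2 + v ^ 2)
    + v * arctan (v / (v ^ 2 + a ^ 2 + a * √(a ^ 2 + v ^ 2 + 1)))
    - a * (√(a ^ 2 + v ^ 2 + 1) - √(a ^ 2 + v ^ 2)) / 2 - 3 / 4

/-- A primitive of `w ↦ (1 - w) log (a + √(a² + v² + w²))`. -/
def innerPrim (a v w : ℝ) : ℝ :=
  w * log (a + √(a ^ 2 + v ^ 2 + w ^ 2)) - w + a * log (w + √(a ^ 2 + v ^ 2 + w ^ 2))
    + v * arctan (w * v / (v ^ 2 + a ^ 2 + a * √(a ^ 2 + v ^ 2 + w ^ 2)))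
    - ((v ^ 2 + w ^ 2) / 2 * log (a + √(a ^ 2 + v ^ 2 + w ^ 2))
      - (a ^ 2 + v ^ 2 + w ^ 2) / 4 + a * √(a ^ 2 + v ^ 2 + w ^ 2) / 2)

lemma hasDerivAt_sqrt_add_sq {c : ℝ} (hc : 0 < c) (w : ℝ) :
    HasDerivAt (fun w => √(c + w ^ 2)) (w / √(c + w ^ 2)) w := by
  have h : HasDerivAt (fun w : ℝ => c + w ^ 2) (2 * w) w := by
    simpa using (hasDerivAt_pow 2 w).const_add c
  convert h.sqrt (by positivity) using 1
  field_simp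

lemma add_sqrt_add_sq_pos {c : ℝ} (hc : 0 < c) (w : ℝ) : 0 < w + √(c + w ^ 2) := by
  have : |w| < √(c + w ^ 2) := by
    rw [← sqrt_sq_eq_abs]; exact sqrt_lt_sqrt (sq_nonneg _) (by linarith)
  linarith [neg_abs_le w]

lemma hasDerivAt_log_add_sqrt {c : ℝ} (hc : 0 < c) (w : ℝ) :
    HasDerivAt (fun w => log (w + √(c + w ^ 2))) (1 / √(c + w ^ 2)) w := by
  refine (((hasDerivAt_id w).add (hasDerivAt_sqrt_add_sq hc w)).log
    (add_sqrt_add_sq_pos hc w).ne').congr_deriv ?_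
  have h1 : 0 < √(c + w ^ 2) := by positivity
  have h2 := add_sqrt_add_sq_pos hc w
  simp only [Pi.add_apply, id]
  field_simp
  ring

lemma hasDerivAt_log_const_add_sqrt {a c : ℝ} (ha : 0 ≤ a) (hc : 0 < c) (w : ℝ) :
    HasDerivAt (fun w => log (a + √(c + w ^ 2))) (w / (√(c + w ^ 2) * (a + √(c + w ^ 2)))) w := by
  have h1 : 0 < √(c + w ^ 2) := by positivity
  refine (((hasDerivAt_sqrt_add_sq hc w).const_add a).log (by positivity)).congr_deriv ?_
  field_simp

/-- The arctangent in `innerPrim` is arctan (w / v) - arctan (a w / (v R)), with R the square root,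
merged into one term whose denominator does not vanish for v > 0. -/
lemma hasDerivAt_innerPrim {a v : ℝ} (ha : 0 ≤ a) (hv : 0 < v) (w : ℝ) :
    HasDerivAt (innerPrim a v) ((1 - w) * log (a + √(a ^ 2 + v ^ 2 + w ^ 2))) w := by
  have hc : 0 < a ^ 2 + v ^ 2 := by positivity
  have hR := hasDerivAt_sqrt_add_sq hc w
  have hA := hasDerivAt_log_const_add_sqrt ha hc w
  have hS := hasDerivAt_log_add_sqrt hc w
  have hpos : 0 < √(a ^ 2 + v ^ 2 + w ^ 2) := by positivity
  have hsq : √(a ^ 2 + v ^ 2 + w ^ 2) ^ 2 = a ^ 2 + v ^ 2 + w ^ 2 := sq_sqrt (by positivity)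
  have hD : 0 < v ^ 2 + a ^ 2 + a * √(a ^ 2 + v ^ 2 + w ^ 2) := by positivity
  have hT : HasDerivAt (fun w => arctan (w * v / (v ^ 2 + a ^ 2 + a * √(a ^ 2 + v ^ 2 + w ^ 2))))
      (v / (√(a ^ 2 + v ^ 2 + w ^ 2) * (a + √(a ^ 2 + v ^ 2 + w ^ 2)))) w := by
    have h := (((hasDerivAt_id w).mul_const v).div
      ((hR.const_mul a).const_add (v ^ 2 + a ^ 2)) hD.ne').arctan
    refine h.congr_deriv ?_
    simp only [id, Pi.div_apply]
    generalize √(a ^ 2 + v ^ 2 + w ^ 2) = R at *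
    -- This factorization makes the arctangent's derivative collapse to v / (R (a + R)).
    have e : (v ^ 2 + a ^ 2 + a * R) ^ 2 + (w * v) ^ 2 = (a ^ 2 + v ^ 2) * (a + R) ^ 2 := by
      linear_combination (-v ^ 2) * hsq
    have e' : 1 + (w * v / (v ^ 2 + a ^ 2 + a * R)) ^ 2
        = (a ^ 2 + v ^ 2) * (a + R) ^ 2 / (v ^ 2 + a ^ 2 + a * R) ^ 2 := by
      rw [← e]; field_simp
    rw [e']
    field_simp
    linear_combination a * hsq
  have hw := hasDerivAt_id w
  have hw2 := hasDerivAt_pow 2 w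
  have h := ((((hw.mul hA).sub hw).add (hS.const_mul a)).add (hT.const_mul v)).sub
    (((((hw2.const_add (v ^ 2)).div_const 2).mul hA).sub
      ((hw2.const_add (a ^ 2 + v ^ 2)).div_const 4)).add ((hR.const_mul a).div_const 2))
  refine h.congr_deriv ?_
  simp only [id]
  generalize log _ = l
  generalize √(a ^ 2 + v ^ 2 + w ^ 2) = R at *
  have e : v ^ 2 = R ^ 2 - a ^ 2 - w ^ 2 := by linear_combination -hsq
  push_cast
  field_simp
  rw [e]
  ring

lemma integral_innerLog {a v : ℝ} (ha : 0 ≤ a) (hv : 0 < v) :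
    ∫ w in (0 : ℝ)..1, (1 - w) * log (a + √(a ^ 2 + v ^ 2 + w ^ 2)) = innerLog a v := by
  rw [intervalIntegral.integral_eq_sub_of_hasDerivAt (f := innerPrim a v)
    (fun w _ => hasDerivAt_innerPrim ha hv w)]
  · simp only [innerPrim, innerLog, ne_eq, OfNat.ofNat_ne_zero, not_false_eq_true, zero_pow,
      add_zero, zero_mul, zero_div, arctan_zero, one_pow, one_mul, zero_add, mul_zero]
    ring
  · apply Continuous.intervalIntegrable
    have : ∀ w : ℝ, a + √(a ^ 2 + v ^ 2 + w ^ 2) ≠ 0 := fun w => by positivity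
    fun_prop (disch := assumption)

/-! ### The outer integral, over v, for a > 0 -/

lemma hasDerivAt_primitive_sq_div_sqrt {c : ℝ} (hc : 0 < c) (x : ℝ) :
    HasDerivAt (fun x => x * √(c + x ^ 2) / 2 - c / 2 * log (x + √(c + x ^ 2)))
      (x ^ 2 * (1 / √(c + x ^ 2))) x := by
  have h := (((hasDerivAt_id x).mul (hasDerivAt_sqrt_add_sq hc x)).div_const 2).sub
    ((hasDerivAt_log_add_sqrt hc x).const_mul (c / 2))
  refine h.congr_deriv ?_
  have h1 : 0 < √(c + x ^ 2) := by positivity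
  have h2 : √(c + x ^ 2) ^ 2 = c + x ^ 2 := sq_sqrt (by positivity)
  simp only [id]
  field_simp
  linear_combination h2

lemma hasDerivAt_primitive_cube_div_sqrt {c : ℝ} (hc : 0 < c) (x : ℝ) :
    HasDerivAt (fun x => √(c + x ^ 2) ^ 3 / 3 - c * √(c + x ^ 2))
      (x ^ 3 * (1 / √(c + x ^ 2))) x := by
  have h := (((hasDerivAt_sqrt_add_sq hc x).pow 3).div_const 3).sub
    ((hasDerivAt_sqrt_add_sq hc x).const_mul c)
  refine h.congr_deriv ?_
  have h1 : 0 < √(c + x ^ 2) := by positivity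
  have h2 : √(c + x ^ 2) ^ 2 = c + x ^ 2 := sq_sqrt (by positivity)
  push_cast
  field_simp
  linear_combination x * h2

lemma hasDerivAt_primitive_sqrt {c : ℝ} (hc : 0 < c) (x : ℝ) :
    HasDerivAt (fun x => x * √(c + x ^ 2) / 2 + c / 2 * log (x + √(c + x ^ 2)))
      (√(c + x ^ 2)) x := by
  have h := (((hasDerivAt_id x).mul (hasDerivAt_sqrt_add_sq hc x)).div_const 2).add
    ((hasDerivAt_log_add_sqrt hc x).const_mul (c / 2))
  refine h.congr_deriv ?_
  have h1 : 0 < √(c + x ^ 2) := by positivity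
  have h2 : √(c + x ^ 2) ^ 2 = c + x ^ 2 := sq_sqrt (by positivity)
  simp only [id]
  field_simp
  linear_combination -h2

lemma hasDerivAt_primitive_mul_sqrt {c : ℝ} (hc : 0 < c) (x : ℝ) :
    HasDerivAt (fun x => √(c + x ^ 2) ^ 3 / 3) (x * √(c + x ^ 2)) x := by
  have h := ((hasDerivAt_sqrt_add_sq hc x).pow 3).div_const 3
  refine h.congr_deriv ?_
  have h1 : 0 < √(c + x ^ 2) := by positivity
  push_cast
  field_simp

lemma hasDerivAt_log_const_add_sqrt_of_sq {a c d : ℝ} (ha : 0 ≤ a) (hc : 0 < c) (hd : 0 < d)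
    (h : c = a ^ 2 + d) (x : ℝ) :
    HasDerivAt (fun x => log (a + √(c + x ^ 2)))
      (x * (1 / (d + x ^ 2)) * (1 - a * (1 / √(c + x ^ 2)))) x := by
  refine (hasDerivAt_log_const_add_sqrt ha hc x).congr_deriv ?_
  have h1 : 0 < √(c + x ^ 2) := by positivity
  have h2 : √(c + x ^ 2) ^ 2 = c + x ^ 2 := sq_sqrt (by positivity)
  field_simp
  linear_combination x * (-h2 - h)

lemma hasDerivAt_arctan_mul_div_sqrt (a x : ℝ) :
    HasDerivAt (fun x => arctan (a * x / √(a ^ 2 + 1 + x ^ 2)))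
      (a * (1 / √(a ^ 2 + 1 + x ^ 2)) * (1 / (1 + x ^ 2))) x := by
  have h1 : 0 < √(a ^ 2 + 1 + x ^ 2) := by positivity
  have h2 : √(a ^ 2 + 1 + x ^ 2) ^ 2 = a ^ 2 + 1 + x ^ 2 := sq_sqrt (by positivity)
  have h := (((hasDerivAt_id x).const_mul a).div
    (hasDerivAt_sqrt_add_sq (c := a ^ 2 + 1) (by positivity) x) h1.ne').arctan
  refine h.congr_deriv ?_
  simp only [id, Pi.div_apply]
  generalize √(a ^ 2 + 1 + x ^ 2) = R at *
  have e : 1 + (a * x / R) ^ 2 = (1 + x ^ 2) * (1 + a ^ 2) / R ^ 2 := by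
    field_simp
    linear_combination h2
  rw [e]
  field_simp
  linear_combination a * h2

lemma hasDerivAt_arctan_div_mul_sqrt {a : ℝ} (ha : 0 < a) (x : ℝ) :
    HasDerivAt (fun x => arctan (x / (a * √(a ^ 2 + 1 + x ^ 2))))
      (a * (1 / √(a ^ 2 + 1 + x ^ 2)) * (1 / (a ^ 2 + x ^ 2))) x := by
  have h1 : 0 < √(a ^ 2 + 1 + x ^ 2) := by positivity
  have h2 : √(a ^ 2 + 1 + x ^ 2) ^ 2 = a ^ 2 + 1 + x ^ 2 := sq_sqrt (by positivity)
  have h := ((hasDerivAt_id x).div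
    ((hasDerivAt_sqrt_add_sq (c := a ^ 2 + 1) (by positivity) x).const_mul a)
    (by positivity)).arctan
  refine h.congr_deriv ?_
  simp only [id, Pi.div_apply]
  generalize √(a ^ 2 + 1 + x ^ 2) = R at *
  have e : 1 + (x / (a * R)) ^ 2 = (a ^ 2 + x ^ 2) * (1 + a ^ 2) / (a * R) ^ 2 := by
    field_simp
    linear_combination a ^ 2 * h2
  rw [e]
  field_simp
  linear_combination h2

/-- The function has the derivative of arctan (a x / R) + arctan (x / (a R)) - arctan x, which is
why the two preceding arctangents appear in `outerPrim`. -/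
lemma hasDerivAt_arctan_diff {a : ℝ} (ha : 0 < a) (x : ℝ) :
    HasDerivAt (fun x => arctan (x / (x ^ 2 + a ^ 2 + a * √(a ^ 2 + 1 + x ^ 2))))
      (a * (1 / √(a ^ 2 + 1 + x ^ 2)) * (1 / (1 + x ^ 2) + 1 / (a ^ 2 + x ^ 2))
        - 1 / (1 + x ^ 2)) x := by
  have h1 : 0 < √(a ^ 2 + 1 + x ^ 2) := by positivity
  have h2 : √(a ^ 2 + 1 + x ^ 2) ^ 2 = a ^ 2 + 1 + x ^ 2 := sq_sqrt (by positivity)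
  have h := ((hasDerivAt_id x).div (((hasDerivAt_pow 2 x).add_const (a ^ 2)).add
    ((hasDerivAt_sqrt_add_sq (c := a ^ 2 + 1) (by positivity) x).const_mul a))
    (by simp only [Pi.add_apply]; positivity)).arctan
  refine h.congr_deriv ?_
  simp only [id, Pi.div_apply, Pi.add_apply]
  generalize √(a ^ 2 + 1 + x ^ 2) = R at *
  have e : 1 + (x / (x ^ 2 + a ^ 2 + a * R)) ^ 2
      = (a ^ 2 + x ^ 2) * (a + R) ^ 2 / (x ^ 2 + a ^ 2 + a * R) ^ 2 := by
    field_simp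
    linear_combination (-x ^ 2) * h2
  -- Since R² = a² + 1 + x², both 1 + x² = R² - a² and a² + x² = R² - 1 become polynomials in R.
  have e2 : (1 : ℝ) / (1 + x ^ 2) = 1 / ((R - a) * (R + a)) := by
    congr 1; linear_combination -h2
  have h3 : R - a ≠ 0 := by
    intro h3
    have : R = a := by linarith
    rw [this] at h2; nlinarith
  have h4 : R ^ 2 - 1 ≠ 0 := by
    have : 0 < a ^ 2 := by positivity
    nlinarith
  have hx : x ^ 2 = R ^ 2 - a ^ 2 - 1 := by linear_combination -h2
  have hx' : a ^ 2 + x ^ 2 = R ^ 2 - 1 := by linear_combination -h2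
  have hD : x ^ 2 + a ^ 2 + a * R ≠ 0 := by positivity
  rw [e, e2, hx']
  push_cast
  field_simp
  rw [hx]
  ring

/-- A primitive of `x ↦ (1 - x) * innerLog a x` for `0 < a`. -/
def outerPrim (a x : ℝ) : ℝ :=
  (x - x ^ 2 / 2 - x ^ 3 / 3 + x ^ 4 / 4 - 3 / 4) / 2 * log (a + √(a ^ 2 + 1 + x ^ 2))
    - (4 / 3 * x - 3 / 8 * x ^ 2 - x ^ 3 / 9 + x ^ 4 / 16 - 4 / 3 * arctan x) / 2
    + a / 2 * (4 / 3 * log (x + √(a ^ 2 + 1 + x ^ 2)) - 3 / 4 * √(a ^ 2 + 1 + x ^ 2)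
      - 1 / 3 * (x * √(a ^ 2 + 1 + x ^ 2) / 2
        - (a ^ 2 + 1) / 2 * log (x + √(a ^ 2 + 1 + x ^ 2)))
      + 1 / 4 * (√(a ^ 2 + 1 + x ^ 2) ^ 3 / 3 - (a ^ 2 + 1) * √(a ^ 2 + 1 + x ^ 2)))
    - 2 / 3 * arctan (a * x / √(a ^ 2 + 1 + x ^ 2))
    + (x ^ 3 / 3 - x ^ 4 / 4) / 2 * log (a + √(a ^ 2 + x ^ 2)) - (x ^ 3 / 9 - x ^ 4 / 16) / 2
    + a / 2 * (1 / 3 * (x * √(a ^ 2 + x ^ 2) / 2 - a ^ 2 / 2 * log (x + √(a ^ 2 + x ^ 2)))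
      - 1 / 4 * (√(a ^ 2 + x ^ 2) ^ 3 / 3 - a ^ 2 * √(a ^ 2 + x ^ 2)))
    + a * (x - x ^ 2 / 2 - a ^ 2 / 2) * (log (1 + √(a ^ 2 + 1 + x ^ 2)) - log √(a ^ 2 + x ^ 2))
    + a * (log (x + √(a ^ 2 + 1 + x ^ 2)) - √(a ^ 2 + 1 + x ^ 2) / 2)
    - a ^ 2 * arctan (x / (a * √(a ^ 2 + 1 + x ^ 2)))
    + (x ^ 2 / 2 - x ^ 3 / 3 + 1 / 2) * arctan (x / (x ^ 2 + a ^ 2 + a * √(a ^ 2 + 1 + x ^ 2)))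
    + (x / 2 - x ^ 2 / 6) - a * (log (x + √(a ^ 2 + 1 + x ^ 2)) - 2 / 3 * √(a ^ 2 + 1 + x ^ 2))
    + 1 / 3 * log (a + √(a ^ 2 + 1 + x ^ 2))
    - a ^ 3 / 3 * (log √(a ^ 2 + x ^ 2) - log (1 + √(a ^ 2 + 1 + x ^ 2)))
    - (1 - a ^ 2) / 2 * arctan (x / (a * √(a ^ 2 + 1 + x ^ 2)))
    - a / 2 * (x * √(a ^ 2 + 1 + x ^ 2) / 2
        + (a ^ 2 + 1) / 2 * log (x + √(a ^ 2 + 1 + x ^ 2)) - √(a ^ 2 + 1 + x ^ 2) ^ 3 / 3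
      - (x * √(a ^ 2 + x ^ 2) / 2 + a ^ 2 / 2 * log (x + √(a ^ 2 + x ^ 2)))
      + √(a ^ 2 + x ^ 2) ^ 3 / 3)
    - 3 / 4 * (x - x ^ 2 / 2)

/-- `outerPrim` comes from integrating each term of (1 - x) `innerLog a x` by parts. The integration
constants -3/4, -a²/2 and 1/2 in the polynomial factors are chosen so that the division by 1 + x²
(for the middle one, by a² + x²) leaves a single remainder term. -/
lemma hasDerivAt_outerPrim {a : ℝ} (ha : 0 < a) (x : ℝ) :
    HasDerivAt (outerPrim a) ((1 - x) * innerLog a x) x := by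
  have hc : 0 < a ^ 2 + 1 := by positivity
  have hd : 0 < a ^ 2 := by positivity
  have x1 := hasDerivAt_id x
  have x2 := hasDerivAt_pow 2 x
  have x3 := hasDerivAt_pow 3 x
  have x4 := hasDerivAt_pow 4 x
  have hA := hasDerivAt_log_const_add_sqrt_of_sq ha.le hc one_pos rfl x
  have hB := hasDerivAt_log_const_add_sqrt ha.le hd x
  have hC := hasDerivAt_log_const_add_sqrt_of_sq zero_le_one hc hd (by ring) x
  have hb := hasDerivAt_sqrt_add_sq hd x
  have hL := hb.log (by positivity)
  have hR := hasDerivAt_sqrt_add_sq hc x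
  have hS := hasDerivAt_log_add_sqrt hc x
  have hR2 := hasDerivAt_primitive_sq_div_sqrt hc x
  have hR3 := hasDerivAt_primitive_cube_div_sqrt hc x
  have hb2 := hasDerivAt_primitive_sq_div_sqrt hd x
  have hb3 := hasDerivAt_primitive_cube_div_sqrt hd x
  have hU := hasDerivAt_arctan_mul_div_sqrt a x
  have hV := hasDerivAt_arctan_div_mul_sqrt ha x
  have hθ := hasDerivAt_arctan_diff ha x
  have hpR := hasDerivAt_primitive_sqrt hc x
  have hpb := hasDerivAt_primitive_sqrt hd x
  have hqR := hasDerivAt_primitive_mul_sqrt hc x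
  have hqb := hasDerivAt_primitive_mul_sqrt hd x
  have h := ((((((((((((((((((((((x1.sub (x2.div_const 2)).sub (x3.div_const 3)).add
    (x4.div_const 4)).sub_const (3 / 4)).div_const 2).mul hA).sub
    ((((((x1.const_mul (4 / 3)).sub (x2.const_mul (3 / 8))).sub (x3.div_const 9)).add
      (x4.div_const 16)).sub ((hasDerivAt_arctan x).const_mul (4 / 3))).div_const 2)).add
    (((((hS.const_mul (4 / 3)).sub (hR.const_mul (3 / 4))).sub (hR2.const_mul (1 / 3))).add
      (hR3.const_mul (1 / 4))).const_mul (a / 2))).sub (hU.const_mul (2 / 3))).add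
    ((((x3.div_const 3).sub (x4.div_const 4)).div_const 2).mul hB)).sub
    (((x3.div_const 9).sub (x4.div_const 16)).div_const 2)).add
    (((hb2.const_mul (1 / 3)).sub (hb3.const_mul (1 / 4))).const_mul (a / 2))).add
    ((((x1.sub (x2.div_const 2)).sub_const (a ^ 2 / 2)).const_mul a).mul (hC.sub hL))).add
    ((hS.sub (hR.div_const 2)).const_mul a)).sub (hV.const_mul (a ^ 2))).add
    ((((x2.div_const 2).sub (x3.div_const 3)).add_const (1 / 2)).mul hθ)).add
    ((x1.div_const 2).sub (x2.div_const 6))).sub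
    ((hS.sub (hR.const_mul (2 / 3))).const_mul a)).add (hA.const_mul (1 / 3))).sub
    ((hL.sub hC).const_mul (a ^ 3 / 3))).sub (hV.const_mul ((1 - a ^ 2) / 2))).sub
    ((((hpR.sub hqR).sub hpb).add hqb).const_mul (a / 2))).sub
    ((x1.sub (x2.div_const 2)).const_mul (3 / 4))
  refine HasDerivAt.congr_deriv (f := outerPrim a) h ?_
  have eR : a ^ 2 + x ^ 2 + 1 = a ^ 2 + 1 + x ^ 2 := by ring
  have hRpos : 0 < √(a ^ 2 + 1 + x ^ 2) := by positivity
  have hbpos : 0 < √(a ^ 2 + x ^ 2) := by positivity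
  have hbsq : √(a ^ 2 + x ^ 2) ^ 2 = a ^ 2 + x ^ 2 := sq_sqrt (by positivity)
  have hx : x ^ 2 * (1 / (√(a ^ 2 + x ^ 2) * (a + √(a ^ 2 + x ^ 2))))
      = 1 - a * (1 / √(a ^ 2 + x ^ 2)) := by
    field_simp
    linear_combination -hbsq
  have hl : x / √(a ^ 2 + x ^ 2) / √(a ^ 2 + x ^ 2) = x * (1 / (a ^ 2 + x ^ 2)) := by
    rw [div_div, ← sq, hbsq, mul_one_div]
  have hq : (1 + x ^ 2) * (1 / (1 + x ^ 2)) = 1 := by field_simp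
  have hp : (a ^ 2 + x ^ 2) * (1 / (a ^ 2 + x ^ 2)) = 1 := by field_simp
  simp only [id, Pi.sub_apply, Pi.add_apply, innerLog, eR]
  rw [hl, div_eq_mul_one_div x (_ * _), div_eq_mul_one_div x √(a ^ 2 + 1 + x ^ 2)]
  -- The claim is now polynomial once the reciprocals are treated as independent variables; only
  -- these three relations between them are needed.
  clear * - hx hq hp
  generalize 1 / (√(a ^ 2 + x ^ 2) * (a + √(a ^ 2 + x ^ 2))) = t at *
  generalize 1 / √(a ^ 2 + 1 + x ^ 2) = r at *
  generalize 1 / √(a ^ 2 + x ^ 2) = s at *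
  generalize 1 / (1 + x ^ 2) = q at *
  generalize 1 / (a ^ 2 + x ^ 2) = p at *
  -- The coefficients of `hq` and `hp` are the quotients of those polynomial divisions.
  linear_combination (1 / 2 * (4 / 3 - 3 / 4 * x - x ^ 2 / 3 + x ^ 3 / 4) * (1 - a * r)
      + (1 / 2 - x / 3) * (a * r - 1)) * hq
    + (-a * (1 - x / 2) * r + (1 / 2 - x / 3) * a * r) * hp
    + 1 / 2 * (x ^ 2 / 3 - x ^ 3 / 4) * hx

lemma continuous_outer {a : ℝ} (ha : 0 < a) : Continuous fun x => (1 - x) * innerLog a x := by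
  unfold innerLog
  have h1 : ∀ x : ℝ, a + √(a ^ 2 + x ^ 2 + 1) ≠ 0 := fun x => by positivity
  have h2 : ∀ x : ℝ, a + √(a ^ 2 + x ^ 2) ≠ 0 := fun x => by positivity
  have h3 : ∀ x : ℝ, 1 + √(a ^ 2 + x ^ 2 + 1) ≠ 0 := fun x => by positivity
  have h4 : ∀ x : ℝ, √(a ^ 2 + x ^ 2) ≠ 0 := fun x => by positivity
  have h5 : ∀ x : ℝ, x ^ 2 + a ^ 2 + a * √(a ^ 2 + x ^ 2 + 1) ≠ 0 := fun x => by positivity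
  fun_prop (disch := assumption)

lemma integral_outer {a : ℝ} (ha : 0 < a) :
    ∫ x in (0 : ℝ)..1, (1 - x) * innerLog a x = outerPrim a 1 - outerPrim a 0 :=
  intervalIntegral.integral_eq_sub_of_hasDerivAt (fun x _ => hasDerivAt_outerPrim ha x)
    ((continuous_outer ha).intervalIntegrable _ _)

/-! ### The outer integral for a = 0 -/

lemma innerLog_zero {x : ℝ} (hx : 0 < x) :
    innerLog 0 x = (1 - x ^ 2) / 4 * log (1 + x ^ 2) + x ^ 2 / 2 * log x
      + x * (π / 2 - arctan x) - 3 / 4 := by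
  have h1 : x / x ^ 2 = x⁻¹ := by field_simp
  have h2 : log √(x ^ 2 + 1) = log (1 + x ^ 2) / 2 := by
    rw [log_sqrt (by positivity), add_comm]
  simp only [innerLog, ne_eq, OfNat.ofNat_ne_zero, not_false_eq_true, zero_pow, zero_add, zero_mul,
    add_zero, sub_zero, zero_div, sqrt_sq hx.le, h1, h2, arctan_inv_of_pos hx]
  ring

/-- A primitive of `x ↦ (1 - x) * innerLog 0 x` on `(0, ∞)`. -/
def outerPrimZero (x : ℝ) : ℝ :=
  (x - x ^ 2 / 2 - x ^ 3 / 3 + x ^ 4 / 4 - 3 / 4) / 4 * log (1 + x ^ 2)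
    - (4 / 3 * x - 3 / 8 * x ^ 2 - x ^ 3 / 9 + x ^ 4 / 16 - 4 / 3 * arctan x) / 2
    + (x ^ 2 / 3 - x ^ 3 / 4) / 2 * (x * log x) - (x ^ 3 / 9 - x ^ 4 / 16) / 2
    + (x ^ 2 / 2 - x ^ 3 / 3 + 1 / 2) * (π / 2 - arctan x)
    + (x / 2 - x ^ 2 / 6) + 1 / 6 * log (1 + x ^ 2) - 3 / 4 * (x - x ^ 2 / 2)

/-- The logarithm enters only through x log x, which extends continuously to 0; this allows
integration up to the endpoint where differentiability is not available. -/
lemma continuous_outerPrimZero : Continuous outerPrimZero := by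
  unfold outerPrimZero
  have h1 : ∀ x : ℝ, 1 + x ^ 2 ≠ 0 := fun x => by positivity
  have h2 := continuous_mul_log
  fun_prop (disch := assumption)

lemma hasDerivAt_outerPrimZero {x : ℝ} (hx : 0 < x) :
    HasDerivAt outerPrimZero ((1 - x) * innerLog 0 x) x := by
  have x1 := hasDerivAt_id x
  have x2 := hasDerivAt_pow 2 x
  have x3 := hasDerivAt_pow 3 x
  have x4 := hasDerivAt_pow 4 x
  have hT := hasDerivAt_arctan x
  have hL := (x2.const_add 1).log (by positivity)
  have hX := hasDerivAt_mul_log hx.ne'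
  have h := ((((((((((((x1.sub (x2.div_const 2)).sub (x3.div_const 3)).add
    (x4.div_const 4)).sub_const (3 / 4)).div_const 4).mul hL).sub
    ((((((x1.const_mul (4 / 3)).sub (x2.const_mul (3 / 8))).sub (x3.div_const 9)).add
      (x4.div_const 16)).sub (hT.const_mul (4 / 3))).div_const 2)).add
    ((((x2.div_const 3).sub (x3.div_const 4)).div_const 2).mul hX)).sub
    (((x3.div_const 9).sub (x4.div_const 16)).div_const 2)).add
    ((((x2.div_const 2).sub (x3.div_const 3)).add_const (1 / 2)).mul (hT.const_sub (π / 2)))).add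
    ((x1.div_const 2).sub (x2.div_const 6))).add (hL.const_mul (1 / 6))).sub
    ((x1.sub (x2.div_const 2)).const_mul (3 / 4))
  refine HasDerivAt.congr_deriv (f := outerPrimZero) h ?_
  rw [innerLog_zero hx]
  simp only [id, Pi.sub_apply, Pi.add_apply]
  field_simp
  ring

lemma intervalIntegrable_outer_zero :
    IntervalIntegrable (fun x => (1 - x) * innerLog 0 x) volume 0 1 := by
  have h : Continuous fun x : ℝ => (1 - x) * ((1 - x ^ 2) / 4 * log (1 + x ^ 2)
      + x / 2 * (x * log x) + x * (π / 2 - arctan x) - 3 / 4) := by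
    have h1 : ∀ x : ℝ, 1 + x ^ 2 ≠ 0 := fun x => by positivity
    have h2 := continuous_mul_log
    fun_prop (disch := assumption)
  refine (h.intervalIntegrable 0 1).congr fun x hx => ?_
  rw [uIoc_of_le zero_le_one] at hx
  simp only [innerLog_zero hx.1]
  ring

lemma integral_outer_zero :
    ∫ x in (0 : ℝ)..1, (1 - x) * innerLog 0 x = outerPrimZero 1 - outerPrimZero 0 :=
  intervalIntegral.integral_eq_sub_of_hasDerivAt_of_le zero_le_one
    continuous_outerPrimZero.continuousOn (fun _ hx => hasDerivAt_outerPrimZero hx.1)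
    intervalIntegrable_outer_zero

/-! ### Special values and the two closed forms -/

lemma log_two_add_sqrt_five : log (2 + √5) = 3 * log (1 + √5) - 3 * log 2 := by
  have h5 : √5 ^ 2 = 5 := sq_sqrt (by norm_num)
  -- The cube of the golden ratio.
  have h : 2 + √5 = ((1 + √5) / 2) ^ 3 := by linear_combination (-3 / 8 - √5 / 8) * h5
  rw [h, log_pow, log_div (by positivity) (by norm_num)]
  push_cast; ring

lemma log_four_add_sqrt_six : log (4 + √6) = log 5 + log (2 + √6) - log (1 + √6) := by
  have h6 : √6 ^ 2 = 6 := sq_sqrt (by norm_num)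
  have h : (1 + √6) * (4 + √6) = 5 * (2 + √6) := by linear_combination h6
  have := congrArg log h
  rw [log_mul (by positivity) (by positivity), log_mul (by positivity) (by positivity)] at this
  linarith

lemma arctan_two_mul_sqrt_six : arctan (2 * √6) = π / 2 - arctan (1 / (2 * √6)) := by
  rw [one_div, arctan_inv_of_pos (by positivity)]; ring

lemma arctan_two_div_sqrt_six : arctan (2 / √6) = π / 4 - arctan (1 / (2 * √6)) / 2 := by
  have h6 : √6 ^ 2 = 6 := sq_sqrt (by norm_num)
  have h0 : 0 < √6 := by positivity
  have h : 2 * arctan (2 / √6) = arctan (2 * √6) := by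
    rw [two_mul_arctan (by linarith [show 0 < 2 / √6 by positivity])
      (by rw [div_lt_one h0]; exact lt_sqrt_of_sq_lt (by norm_num))]
    congr 1
    rw [div_pow, h6]
    field_simp
    norm_num
  rw [arctan_two_mul_sqrt_six] at h
  linarith

lemma arctan_inv_five_add : arctan (1 / (5 + 2 * √6)) = arctan (1 / (2 * √6)) / 2 := by
  have h6 : √6 ^ 2 = 6 := sq_sqrt (by norm_num)
  have h0 : 0 < √6 := by positivity
  have h1 : 1 / (5 + 2 * √6) < 1 := by rw [div_lt_one (by positivity)]; linarith
  have h : 2 * arctan (1 / (5 + 2 * √6)) = arctan (1 / (2 * √6)) := by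
    rw [two_mul_arctan (by linarith [show 0 < 1 / (5 + 2 * √6) by positivity]) h1]
    congr 1
    have h2 : (5 + 2 * √6) ^ 2 - 1 ≠ 0 := by nlinarith
    have h3 : 1 - (1 / (5 + 2 * √6)) ^ 2 = ((5 + 2 * √6) ^ 2 - 1) / (5 + 2 * √6) ^ 2 := by
      field_simp
    rw [h3]
    field_simp
    linear_combination 4 * h6
  linarith

lemma arctan_one_div_sqrt_three : arctan (1 / √3) = π / 6 := by
  rw [← tan_pi_div_six, arctan_tan] <;> linarith [pi_pos]

lemma arctan_inv_two_add : arctan (1 / (2 + √3)) = π / 12 := by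
  have h3 : √3 ^ 2 = 3 := sq_sqrt (by norm_num)
  have h0 : 0 < √3 := by positivity
  have h1 : 1 / (2 + √3) < 1 := by rw [div_lt_one (by positivity)]; linarith
  have h : 2 * arctan (1 / (2 + √3)) = arctan (1 / √3) := by
    rw [two_mul_arctan (by linarith [show 0 < 1 / (2 + √3) by positivity]) h1]
    congr 1
    have h2 : (2 + √3) ^ 2 - 1 ≠ 0 := by nlinarith
    have h4 : 1 - (1 / (2 + √3)) ^ 2 = ((2 + √3) ^ 2 - 1) / (2 + √3) ^ 2 := by
      field_simp
    rw [h4]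
    field_simp
    linear_combination h3
  rw [arctan_one_div_sqrt_three] at h
  linarith

lemma closedForm_eq_fornbergForm : closedForm = fornbergForm := by
  rw [closedForm, fornbergForm, log_two_add_sqrt_five, log_four_add_sqrt_six,
    arctan_two_mul_sqrt_six, arctan_two_div_sqrt_six]
  ring

/-- At x = 1 the radicals are √3, √2 for a = 1 and √6, √5 for a = 2. The half-angle lemmas bring
every arctangent to a multiple of π or to arctan (1 / (2√6)). -/
lemma outer_combination_eq_closedForm :
    4 * (2 * (outerPrim 1 1 - outerPrim 1 0) - (outerPrim 2 1 - outerPrim 2 0)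
      - (outerPrimZero 1 - outerPrimZero 0)) = closedForm := by
  have s2 : √2 ^ 3 = 2 * √2 := by rw [pow_succ, sq_sqrt (by norm_num)]
  have s3 : √3 ^ 3 = 3 * √3 := by rw [pow_succ, sq_sqrt (by norm_num)]
  have s5 : √5 ^ 3 = 5 * √5 := by rw [pow_succ, sq_sqrt (by norm_num)]
  have s6 : √6 ^ 3 = 6 * √6 := by rw [pow_succ, sq_sqrt (by norm_num)]
  have l2 : log √2 = log 2 / 2 := log_sqrt (by norm_num)
  have l5 : log √5 = log 5 / 2 := log_sqrt (by norm_num)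
  have l4 : log 4 = 2 * log 2 := by
    rw [show (4 : ℝ) = 2 ^ 2 by norm_num, log_pow]; norm_num
  have r4 : √4 = 2 := by rw [show (4 : ℝ) = 2 ^ 2 by norm_num, sqrt_sq (by norm_num)]
  have e1 := arctan_inv_two_add
  have e2 := arctan_inv_five_add
  have e3 := arctan_two_div_sqrt_six
  rw [closedForm, e3]
  simp only [outerPrim, outerPrimZero]
  norm_num [s2, s3, s5, s6, l2, l5, l4, r4, -one_div, arctan_one_div_sqrt_three, e1, e2, e3, log_two_add_sqrt_five]
  ring

/-! ### The integral along the line of centers -/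

/-- The force kernel integrated against the overlap length in the direction of the force. -/
def overlapLog (v w : ℝ) : ℝ :=
  2 * log (1 + √(1 ^ 2 + v ^ 2 + w ^ 2)) - log (2 + √(2 ^ 2 + v ^ 2 + w ^ 2))
    - log (0 + √(0 ^ 2 + v ^ 2 + w ^ 2))

lemma rpow_three_halves {y : ℝ} (hy : 0 ≤ y) : y ^ (3 / 2 : ℝ) = √y ^ 3 := by
  rw [sqrt_eq_rpow, ← rpow_natCast, ← rpow_mul hy]
  norm_num

lemma hasDerivAt_div_sqrt {c : ℝ} (hc : 0 < c) (u : ℝ) :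
    HasDerivAt (fun u => u / √(c + u ^ 2)) (c / √(c + u ^ 2) ^ 3) u := by
  have h1 : 0 < √(c + u ^ 2) := by positivity
  have h2 : √(c + u ^ 2) ^ 2 = c + u ^ 2 := sq_sqrt (by positivity)
  refine ((hasDerivAt_id u).div (hasDerivAt_sqrt_add_sq hc u) h1.ne').congr_deriv ?_
  simp only [id]
  field_simp
  linear_combination h2

lemma hasDerivAt_one_div_sqrt {c : ℝ} (hc : 0 < c) (u : ℝ) :
    HasDerivAt (fun u => 1 / √(c + u ^ 2)) (-(u / √(c + u ^ 2) ^ 3)) u := by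
  have h1 : 0 < √(c + u ^ 2) := by positivity
  refine ((hasDerivAt_const u (1 : ℝ)).div (hasDerivAt_sqrt_add_sq hc u) h1.ne').congr_deriv ?_
  field_simp
  ring

lemma continuous_min_mul_kernel {c : ℝ} (hc : 0 < c) :
    Continuous fun u => min u (2 - u) * (u / √(c + u ^ 2) ^ 3) := by
  have : ∀ u : ℝ, √(c + u ^ 2) ^ 3 ≠ 0 := fun u => by positivity
  fun_prop (disch := assumption)

/-- With G(u) = log (u + √(c + u²)), G'' = -u / √(c + u²)³. The hat has second derivative δ₀ - 2δ₁ +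
δ₂, so integrating by parts twice gives 2 G(1) - G(2) - G(0). The proof uses explicit primitives on
either side of the kink at u = 1. -/
lemma integral_min_mul_kernel {c : ℝ} (hc : 0 < c) :
    ∫ u in (0 : ℝ)..2, min u (2 - u) * (u / √(c + u ^ 2) ^ 3)
      = 2 * log (1 + √(c + 1)) - log (2 + √(c + 4)) - log √c := by
  have hi := (continuous_min_mul_kernel hc).intervalIntegrable (μ := volume)
  have hpos : ∀ u : ℝ, 0 < √(c + u ^ 2) := fun u => by positivity
  have hsq : ∀ u : ℝ, √(c + u ^ 2) ^ 2 = c + u ^ 2 := fun u => sq_sqrt (by positivity)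
  rw [← intervalIntegral.integral_add_adjacent_intervals (hi 0 1) (hi 1 2)]
  rw [intervalIntegral.integral_eq_sub_of_hasDerivAt_of_le (a := 0) (b := 1)
    (f := fun u => log (u + √(c + u ^ 2)) - u / √(c + u ^ 2)) zero_le_one
    (fun u _ => ((hasDerivAt_log_add_sqrt hc u).sub
      (hasDerivAt_div_sqrt hc u)).continuousAt.continuousWithinAt) ?_ (hi 0 1),
    intervalIntegral.integral_eq_sub_of_hasDerivAt_of_le (a := 1) (b := 2)
    (f := fun u => (u / √(c + u ^ 2) - log (u + √(c + u ^ 2))) - 2 * (1 / √(c + u ^ 2)))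
    one_le_two (fun u _ => (((hasDerivAt_div_sqrt hc u).sub (hasDerivAt_log_add_sqrt hc u)).sub
      ((hasDerivAt_one_div_sqrt hc u).const_mul 2)).continuousAt.continuousWithinAt) ?_ (hi 1 2)]
  · norm_num
    ring
  · intro u hu
    refine (((hasDerivAt_div_sqrt hc u).sub (hasDerivAt_log_add_sqrt hc u)).sub
      ((hasDerivAt_one_div_sqrt hc u).const_mul 2)).congr_deriv ?_
    rw [min_eq_right (by linarith [hu.1])]
    have := hpos u
    field_simp
    linear_combination -hsq u
  · intro u hu
    refine ((hasDerivAt_log_add_sqrt hc u).sub (hasDerivAt_div_sqrt hc u)).congr_deriv ?_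
    rw [min_eq_left (by linarith [hu.2])]
    have := hpos u
    field_simp
    linear_combination hsq u

lemma min_mul_kernel_nonneg (c : ℝ) {u : ℝ} (hu : u ∈ Ioc (0 : ℝ) 2) :
    0 ≤ min u (2 - u) * (u / √(c + u ^ 2) ^ 3) := by
  have h1 := hu.1.le
  have h2 : 0 ≤ min u (2 - u) := le_min h1 (by linarith [hu.2])
  positivity

lemma overlapLog_eq_integral {v w : ℝ} (h : 0 < v ^ 2 + w ^ 2) :
    overlapLog v w
      = ∫ u in (0 : ℝ)..2, min u (2 - u) * (u / √(v ^ 2 + w ^ 2 + u ^ 2) ^ 3) := by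
  rw [integral_min_mul_kernel h, overlapLog]
  norm_num
  ring_nf

lemma overlapLog_nonneg {v w : ℝ} (h : 0 < v ^ 2 + w ^ 2) : 0 ≤ overlapLog v w := by
  rw [overlapLog_eq_integral h, intervalIntegral.integral_of_le zero_le_two]
  exact setIntegral_nonneg measurableSet_Ioc fun u hu => min_mul_kernel_nonneg _ hu

/-! ### From the sixfold integral to the unit square -/

lemma setLIntegral_Ioc_ofReal {f : ℝ → ℝ} {a b : ℝ} (hab : a ≤ b)
    (hf : IntervalIntegrable f volume a b) (h0 : ∀ x ∈ Ioc a b, 0 ≤ f x) :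
    ∫⁻ x in Ioc a b, ENNReal.ofReal (f x) = ENNReal.ofReal (∫ x in a..b, f x) := by
  rw [intervalIntegral.integral_of_le hab, ofReal_integral_eq_lintegral_ofReal
    ((intervalIntegrable_iff_integrableOn_Ioc_of_le hab).1 hf)]
  exact (ae_restrict_iff' measurableSet_Ioc).2 (ae_of_all _ h0)

lemma lintegral_overlap_mul_kernel {v w : ℝ} (h : 0 < v ^ 2 + w ^ 2) :
    ∫⁻ u, ENNReal.ofReal (u / (u ^ 2 + v ^ 2 + w ^ 2) ^ (3 / 2 : ℝ)) *
      ENNReal.ofReal (min 2 (1 + u) - max 1 u) = ENNReal.ofReal (overlapLog v w) := by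
  rw [overlapLog_eq_integral h, ← setLIntegral_Ioc_ofReal zero_le_two
    ((continuous_min_mul_kernel h).intervalIntegrable _ _) fun u hu => min_mul_kernel_nonneg _ hu,
    ← lintegral_indicator measurableSet_Ioc]
  refine lintegral_congr fun u => ?_
  -- Outside (0, 2] this length is nonpositive, and `ENNReal.ofReal` truncates it to the true
  -- overlap 0.
  have e : min 2 (1 + u) - max 1 u = min u (2 - u) := by
    rcases le_total u 1 with hu | hu
    · rw [min_eq_right (by linarith), max_eq_left hu, min_eq_left (by linarith)]; ring
    · rw [min_eq_left (by linarith), max_eq_right hu, min_eq_right (by linarith)]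
  rw [e, show u ^ 2 + v ^ 2 + w ^ 2 = v ^ 2 + w ^ 2 + u ^ 2 by ring,
    rpow_three_halves (by positivity)]
  by_cases hu : u ∈ Ioc (0 : ℝ) 2
  · have := hu.1
    rw [indicator_of_mem hu, mul_comm, ENNReal.ofReal_mul (le_min this.le (by linarith [hu.2]))]
  · rw [indicator_of_notMem hu, ENNReal.ofReal_of_nonpos (p := min u (2 - u)), mul_zero]
    rw [mem_Ioc, not_and_or, not_lt, not_le] at hu
    rcases hu with hu | hu
    · exact (min_le_left _ _).trans hu
    · exact (min_le_right _ _).trans (by linarith)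

lemma lintegral_of_even {g : ℝ → ENNReal} (hg : ∀ x, g (-x) = g x) :
    ∫⁻ x, g x = 2 * ∫⁻ x in Ioi 0, g x := by
  rw [← lintegral_add_compl g (measurableSet_Ioi (a := (0 : ℝ))), compl_Ioi, two_mul]
  congr 1
  have h := (Measure.measurePreserving_neg (volume : Measure ℝ)).setLIntegral_comp_preimage_emb
    (MeasurableEquiv.neg ℝ).measurableEmbedding g (Ioi 0)
  rw [← h, setLIntegral_congr Iio_ae_eq_Iic.symm]
  simp [hg]

lemma lintegral_hat_mul {g : ℝ → ENNReal} (hg : ∀ x, g (-x) = g x) :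
    ∫⁻ x, ENNReal.ofReal (min 1 (1 + x) - max 0 x) * g x
      = 2 * ∫⁻ x in Ioc 0 1, ENNReal.ofReal (1 - x) * g x := by
  have e : ∀ x : ℝ, min 1 (1 + x) - max 0 x = 1 - |x| := fun x => by
    rcases le_total 0 x with hx | hx
    · rw [min_eq_left (by linarith), max_eq_right hx, abs_of_nonneg hx]
    · rw [min_eq_right (by linarith), max_eq_left hx, abs_of_nonpos hx]; ring
  simp only [e]
  rw [lintegral_of_even (by simp [hg]), ← Ioc_union_Ioi_eq_Ioi zero_le_one,
    lintegral_union measurableSet_Ioi (Ioc_disjoint_Ioi le_rfl)]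
  have h : ∫⁻ x in Ioi (1 : ℝ), ENNReal.ofReal (1 - |x|) * g x = 0 := by
    rw [setLIntegral_congr_fun (g := fun _ => 0) measurableSet_Ioi, lintegral_zero]
    intro x hx
    have hx' : 1 < x := hx
    simp only
    rw [ENNReal.ofReal_of_nonpos, zero_mul]
    rw [abs_of_pos (by linarith)]; linarith
  rw [h, add_zero]
  congr 1
  refine setLIntegral_congr_fun measurableSet_Ioc fun x hx => ?_
  simp only [abs_of_pos hx.1]

/-- Substitute y = x - t for fixed x, then exchange the order of integration: x ranges over the
points of A with x - t in B. -/
lemma lintegral_lintegral_sub {A B : Set (Fin 3 → ℝ)} (hA : MeasurableSet A)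
    (hB : MeasurableSet B) {k : (Fin 3 → ℝ) → ENNReal} (hk : Measurable k) :
    ∫⁻ x in A, ∫⁻ y in B, k (x - y) = ∫⁻ t, k t * volume (A ∩ {x | x - t ∈ B}) := by
  have hm : Measurable (Function.uncurry fun x t : Fin 3 → ℝ =>
      A.indicator 1 x * (B.indicator 1 (x - t) * k t)) := by
    have h1 : Measurable (A.indicator (1 : (Fin 3 → ℝ) → ENNReal)) := measurable_one.indicator hA
    have h2 : Measurable (B.indicator (1 : (Fin 3 → ℝ) → ENNReal)) := measurable_one.indicator hB
    unfold Function.uncurry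
    fun_prop
  calc ∫⁻ x in A, ∫⁻ y in B, k (x - y)
      = ∫⁻ x, ∫⁻ t, A.indicator 1 x * (B.indicator 1 (x - t) * k t) := by
        rw [← lintegral_indicator hA]
        refine lintegral_congr fun x => ?_
        by_cases hx : x ∈ A
        · simp only [indicator_of_mem hx, Pi.one_apply, one_mul]
          rw [← lintegral_indicator hB, ← lintegral_sub_left_eq_self _ x]
          refine lintegral_congr fun t => ?_
          by_cases ht : x - t ∈ B <;> simp [ht]
        · simp [indicator_of_notMem hx]
    _ = ∫⁻ t, ∫⁻ x, A.indicator 1 x * (B.indicator 1 (x - t) * k t) :=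
        lintegral_lintegral_swap hm.aemeasurable
    _ = ∫⁻ t, k t * volume (A ∩ {x | x - t ∈ B}) := by
        refine lintegral_congr fun t => ?_
        have hS : MeasurableSet (A ∩ {x | x - t ∈ B}) :=
          hA.inter ((measurable_id.sub_const t) hB)
        rw [← lintegral_indicator_one hS, ← lintegral_const_mul _ (measurable_one.indicator hS)]
        refine lintegral_congr fun x => ?_
        by_cases hx : x ∈ A <;> by_cases ht : x - t ∈ B <;> simp [hx, ht]

lemma volume_cube_overlap (t : Fin 3 → ℝ) :
    volume (cubeRight ∩ {x | x - t ∈ cubeLeft})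
      = ENNReal.ofReal (min 2 (1 + t 0) - max 1 (t 0))
        * ENNReal.ofReal (min 1 (1 + t 1) - max 0 (t 1))
        * ENNReal.ofReal (min 1 (1 + t 2) - max 0 (t 2)) := by
  have h : cubeRight ∩ {x | x - t ∈ cubeLeft}
      = Icc (![1, 0, 0] ⊔ (![0, 0, 0] + t)) (![2, 1, 1] ⊓ (![1, 1, 1] + t)) := by
    rw [← Icc_inter_Icc]
    ext x
    simp [cubeRight, cubeLeft, le_sub_iff_add_le]
  rw [h, Real.volume_Icc_pi, Fin.prod_univ_three]
  simp
  rfl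

/-- Coordinate 0 is placed innermost, so that the elementary u-integral is done first. -/
lemma lintegral_fin_three {f : ℝ → ℝ → ℝ → ENNReal}
    (hf : Measurable fun p : ℝ × ℝ × ℝ => f p.1 p.2.1 p.2.2) :
    ∫⁻ t : Fin 3 → ℝ, f (t 0) (t 1) (t 2) = ∫⁻ v, ∫⁻ w, ∫⁻ u, f u v w := by
  have h1 := volume_preserving_piFinSuccAbove (fun _ : Fin 3 => ℝ) 0
  have h2 := (MeasurePreserving.id (volume : Measure ℝ)).prod (volume_preserving_finTwoArrow ℝ)
  have h : ∫⁻ t : Fin 3 → ℝ, f (t 0) (t 1) (t 2)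
      = ∫⁻ p : ℝ × ℝ × ℝ, f p.1 p.2.1 p.2.2 := (h2.comp h1).lintegral_comp hf
  rw [h, Measure.volume_eq_prod, lintegral_prod_symm' _ hf, Measure.volume_eq_prod,
    lintegral_prod _ (by fun_prop)]

lemma measurable_forceKernel :
    Measurable fun p : (Fin 3 → ℝ) × (Fin 3 → ℝ) => forceKernel 0 p.1 p.2 := by
  unfold forceKernel
  fun_prop

lemma lintegral_kernel_eq :
    ∫⁻ x in cubeRight, ∫⁻ y in cubeLeft, ENNReal.ofReal (forceKernel 0 x y)
      = 4 * ∫⁻ v in Ioc (0 : ℝ) 1, ENNReal.ofReal (1 - v) *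
          ∫⁻ w in Ioc (0 : ℝ) 1, ENNReal.ofReal (1 - w) * ENNReal.ofReal (overlapLog v w) := by
  have hk : Measurable fun t : Fin 3 → ℝ =>
      ENNReal.ofReal (t 0 / (t 0 ^ 2 + t 1 ^ 2 + t 2 ^ 2) ^ (3 / 2 : ℝ)) := by fun_prop
  have h1 := lintegral_lintegral_sub (A := cubeRight) (B := cubeLeft) measurableSet_Icc
    measurableSet_Icc hk
  simp only [volume_cube_overlap, Pi.sub_apply] at h1
  simp only [forceKernel]
  rw [h1, lintegral_fin_three (f := fun u v w =>
    ENNReal.ofReal (u / (u ^ 2 + v ^ 2 + w ^ 2) ^ (3 / 2 : ℝ)) *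
      (ENNReal.ofReal (min 2 (1 + u) - max 1 u) * ENNReal.ofReal (min 1 (1 + v) - max 0 v)
        * ENNReal.ofReal (min 1 (1 + w) - max 0 w))) (by fun_prop)]
  have hneg : ∀ v w, overlapLog (-v) w = overlapLog v w := fun v w => by simp [overlapLog]
  have hneg' : ∀ v w, overlapLog v (-w) = overlapLog v w := fun v w => by simp [overlapLog]
  have h2 : ∀ v : ℝ, v ≠ 0 → ∫⁻ w, ∫⁻ u,
      ENNReal.ofReal (u / (u ^ 2 + v ^ 2 + w ^ 2) ^ (3 / 2 : ℝ)) *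
      (ENNReal.ofReal (min 2 (1 + u) - max 1 u) * ENNReal.ofReal (min 1 (1 + v) - max 0 v)
        * ENNReal.ofReal (min 1 (1 + w) - max 0 w))
      = ENNReal.ofReal (min 1 (1 + v) - max 0 v) * (2 * ∫⁻ w in Ioc (0 : ℝ) 1,
          ENNReal.ofReal (1 - w) * ENNReal.ofReal (overlapLog v w)) := by
    intro v hv
    rw [← lintegral_hat_mul (fun w => by rw [hneg']),
      ← lintegral_const_mul' _ _ ENNReal.ofReal_ne_top]
    refine lintegral_congr fun w => ?_
    rw [← lintegral_overlap_mul_kernel (by positivity), ← mul_assoc,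
      ← lintegral_const_mul' _ _ (ENNReal.mul_ne_top ENNReal.ofReal_ne_top ENNReal.ofReal_ne_top)]
    refine lintegral_congr fun u => ?_
    ring
  -- Dropping the null set v = 0 ensures v² + w² > 0 for every w.
  have h3 : ∀ᵐ v : ℝ, v ≠ 0 := by simp [ae_iff]
  rw [lintegral_congr_ae (h3.mono h2), lintegral_hat_mul (fun v => by simp only [hneg])]
  simp only [mul_left_comm _ (2 : ENNReal)]
  rw [lintegral_const_mul' _ _ (by simp), ← mul_assoc]
  norm_num

/-! ### Assembly: value and integrability -/

lemma lintegral_inner_overlapLog {v : ℝ} (hv : 0 < v) :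
    ∫⁻ w in Ioc (0 : ℝ) 1, ENNReal.ofReal (1 - w) * ENNReal.ofReal (overlapLog v w)
      = ENNReal.ofReal (2 * innerLog 1 v - innerLog 2 v - innerLog 0 v) ∧
    0 ≤ 2 * innerLog 1 v - innerLog 2 v - innerLog 0 v := by
  have hi : ∀ a : ℝ, 0 ≤ a → IntervalIntegrable
      (fun w => (1 - w) * log (a + √(a ^ 2 + v ^ 2 + w ^ 2))) volume 0 1 := by
    intro a ha
    apply Continuous.intervalIntegrable
    have : ∀ w : ℝ, a + √(a ^ 2 + v ^ 2 + w ^ 2) ≠ 0 := fun w => by positivity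
    fun_prop (disch := assumption)
  have e : ∀ w, (1 - w) * overlapLog v w = 2 * ((1 - w) * log (1 + √(1 ^ 2 + v ^ 2 + w ^ 2)))
      - (1 - w) * log (2 + √(2 ^ 2 + v ^ 2 + w ^ 2))
      - (1 - w) * log (0 + √(0 ^ 2 + v ^ 2 + w ^ 2)) := fun w => by rw [overlapLog]; ring
  have hI := (((hi 1 zero_le_one).const_mul 2).sub (hi 2 zero_le_two)).sub (hi 0 le_rfl)
  have h0 : ∀ w ∈ Ioc (0 : ℝ) 1, 0 ≤ (1 - w) * overlapLog v w := fun w hw =>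
    mul_nonneg (by linarith [hw.2]) (overlapLog_nonneg (by positivity))
  have hval : ∫ w in (0 : ℝ)..1, (1 - w) * overlapLog v w
      = 2 * innerLog 1 v - innerLog 2 v - innerLog 0 v := by
    simp only [e]
    rw [intervalIntegral.integral_sub (((hi 1 zero_le_one).const_mul 2).sub (hi 2 zero_le_two))
      (hi 0 le_rfl), intervalIntegral.integral_sub ((hi 1 zero_le_one).const_mul 2)
      (hi 2 zero_le_two), intervalIntegral.integral_const_mul, integral_innerLog zero_le_one hv,
      integral_innerLog zero_le_two hv, integral_innerLog le_rfl hv]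
  rw [← hval]
  constructor
  · rw [← setLIntegral_Ioc_ofReal zero_le_one (by simpa only [e] using hI) h0]
    refine setLIntegral_congr_fun measurableSet_Ioc fun w hw => ?_
    exact (ENNReal.ofReal_mul (by linarith [hw.2])).symm
  · rw [intervalIntegral.integral_of_le zero_le_one]
    exact setIntegral_nonneg measurableSet_Ioc h0

/-- Nonnegativity is recorded too because `ENNReal.ofReal` forgets negative values; it is needed to
recover the real integral. -/
lemma lintegral_forceKernel :
    ∫⁻ x in cubeRight, ∫⁻ y in cubeLeft, ENNReal.ofReal (forceKernel 0 x y)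
      = ENNReal.ofReal closedForm ∧ 0 ≤ closedForm := by
  have h1 := (continuous_outer one_pos).intervalIntegrable (μ := volume) 0 1
  have h2 := (continuous_outer two_pos).intervalIntegrable (μ := volume) 0 1
  have hI := ((h1.const_mul 2).sub h2).sub intervalIntegrable_outer_zero
  have e : ∀ v, (1 - v) * (2 * innerLog 1 v - innerLog 2 v - innerLog 0 v)
      = 2 * ((1 - v) * innerLog 1 v) - (1 - v) * innerLog 2 v - (1 - v) * innerLog 0 v :=
    fun v => by ring
  have h0 : ∀ v ∈ Ioc (0 : ℝ) 1, 0 ≤ (1 - v) * (2 * innerLog 1 v - innerLog 2 v - innerLog 0 v) :=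
    fun v hv => mul_nonneg (by linarith [hv.2]) (lintegral_inner_overlapLog hv.1).2
  have hval : 4 * ∫ v in (0 : ℝ)..1, (1 - v) * (2 * innerLog 1 v - innerLog 2 v - innerLog 0 v)
      = closedForm := by
    simp only [e]
    rw [intervalIntegral.integral_sub ((h1.const_mul 2).sub h2) intervalIntegrable_outer_zero,
      intervalIntegral.integral_sub (h1.const_mul 2) h2, intervalIntegral.integral_const_mul,
      integral_outer one_pos, integral_outer two_pos, integral_outer_zero,
      outer_combination_eq_closedForm]
  rw [← hval]
  constructor
  · rw [lintegral_kernel_eq, ENNReal.ofReal_mul (by norm_num),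
      ← setLIntegral_Ioc_ofReal zero_le_one (by simpa only [e] using hI) h0]
    congr 1
    · norm_num
    refine setLIntegral_congr_fun measurableSet_Ioc fun v hv => ?_
    rw [(lintegral_inner_overlapLog hv.1).1, ENNReal.ofReal_mul (by linarith [hv.2])]
  · refine mul_nonneg (by norm_num) ?_
    rw [intervalIntegral.integral_of_le zero_le_one]
    exact setIntegral_nonneg measurableSet_Ioc h0

lemma forceKernel_nonneg {x y : Fin 3 → ℝ} (hx : x ∈ cubeRight) (hy : y ∈ cubeLeft) :
    0 ≤ forceKernel 0 x y := by
  have h1 : (1 : ℝ) ≤ x 0 := by simpa using hx.1 0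
  have h2 : y 0 ≤ (1 : ℝ) := by simpa using hy.2 0
  have h3 : 0 ≤ x 0 - y 0 := by linarith
  unfold forceKernel
  positivity

lemma forceKernel_nonneg_ae :
    0 ≤ᵐ[volume.restrict (cubeRight ×ˢ cubeLeft)]
      fun p : (Fin 3 → ℝ) × (Fin 3 → ℝ) => forceKernel 0 p.1 p.2 :=
  (ae_restrict_iff' (measurableSet_Icc.prod measurableSet_Icc)).2
    (ae_of_all _ fun _ hp => forceKernel_nonneg hp.1 hp.2)

lemma lintegral_prod_forceKernel :
    ∫⁻ p in cubeRight ×ˢ cubeLeft, ENNReal.ofReal (forceKernel 0 p.1 p.2)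
      = ENNReal.ofReal closedForm := by
  rw [← lintegral_forceKernel.1, Measure.volume_eq_prod, ← Measure.prod_restrict,
    lintegral_prod _ measurable_forceKernel.ennreal_ofReal.aemeasurable]

lemma integrableOn_forceKernel :
    IntegrableOn (fun p : (Fin 3 → ℝ) × (Fin 3 → ℝ) => forceKernel 0 p.1 p.2)
      (cubeRight ×ˢ cubeLeft) := by
  refine ⟨measurable_forceKernel.aestronglyMeasurable, ?_⟩
  rw [hasFiniteIntegral_iff_ofReal forceKernel_nonneg_ae, lintegral_prod_forceKernel]
  exact ENNReal.ofReal_lt_top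

lemma twoCubesForce_eq_closedForm : twoCubesForce = closedForm := by
  rw [twoCubesForce, forceComponent, ← setIntegral_prod (fun p => forceKernel 0 p.1 p.2)
    integrableOn_forceKernel, ← Measure.volume_eq_prod,
    integral_eq_lintegral_of_nonneg_ae forceKernel_nonneg_ae
      measurable_forceKernel.aestronglyMeasurable, lintegral_prod_forceKernel,
    ENNReal.toReal_ofReal lintegral_forceKernel.2]

end TwoCubes

end

theorem mainTheorem2 :
    MeasureTheory.IntegrableOn
        (fun p : (Fin 3 → ℝ) × (Fin 3 → ℝ) => TwoCubes.forceKernel 0 p.1 p.2)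
        (TwoCubes.cubeRight ×ˢ TwoCubes.cubeLeft) ∧
      TwoCubes.twoCubesForce = TwoCubes.closedForm ∧
      TwoCubes.closedForm = TwoCubes.fornbergForm := by
  exact ⟨TwoCubes.integrableOn_forceKernel, TwoCubes.twoCubesForce_eq_closedForm,
    TwoCubes.closedForm_eq_fornbergForm⟩
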